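/- Let $(\Omega,\mathbf P)$ be a probability space, let $L^2_0(\Omega)$ be the space of square integrable complex random variables with mean zero, and let $u,w:\mathscr S(\mathbf R^d)\to L^2_0(\Omega)$, $\varphi\mapsto(u,\varphi)$, $\varphi\mapsto(w,\varphi)$, be conjugate linear and continuous (tempered generalized stochastic processes) and uncorrelated, that is $\mathbf E\big((u,\varphi)\overline{(w,\psi)}\big)=0$ for all $\varphi,\psi\in\mathscr S(\mathbf R^d)$. Let $\mathscr K_u:\mathscr S(\mathbf R^d)\to\mathscr S'(\mathbf R^d)$ be the covariance operator of $u$, $(\mathscr K_u\psi,\varphi)=\mathbf E\big((u,\varphi)\overline{(u,\psi)}\big)$, where $(T,\varphi)$ denotes the conjugate linear action of a distribution $T$ on a test function $\varphi$, and likewise $\mathscr K_w$. Let $\mathscr H$ be a Hilbert space of distributions on $\mathbf R^d$, that is a complex Hilbert space continuously included in $\mathscr D'(\mathbf R^d)$. Suppose that $\mathscr K_u$ and $\mathscr K_w$ act as bounded operators on $\mathscr H$, denoted by the same letters (so these bounded operators agree with the covariance operators on all Schwartz functions that belong to $\mathscr H$), that $\mathscr K_u\ge 0$ and $\mathscr K_w\ge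 0$ on $\mathscr H$, and that $\mathscr K_u\mathscr K_w=\mathscr K_w\mathscr K_u$. Then there exist a normalized projection-valued Borel measure $\Pi$ on $\mathbf C$ with values in the orthogonal projections of $\mathscr H$, supported in a compact subset of the closed first quadrant $\mathbf C_+=\{x+iy:\ x\ge 0,\ y\ge 0\}$, and non-negative functions $f_u,f_w\in C_c(\mathbf C_+)$ such that $$\mathscr K_u=\int_{\mathbf C_+} f_u\,d\Pi,\qquad \mathscr K_w=\int_{\mathbf C_+} f_w\,d\Pi .$$ With $$f=\frac{f_u}{f_u+f_w}\,\chi_{\operatorname{supp} f_u}\qquad(\text{where } f=0 \text{ at points with } f_u=f_w=0),$$ the function $f$ is bounded and Borel measurable, and the bounded operator $F=\int_{\mathbf C_+} f\,d\Pi$ solves $\mathscr K_u=F(\mathscr K_u+\mathscr K_w)$ and satisfies $F\ge 0$. The solution is unique in the bounded functional calculus $\{\int g\,d\Pi:\ g \text{ bounded Borel}\}$ of $\Pi$ up to the kernel of $\mathscr K_u+\mathscr K_w$, in the following sense: 1. for a bounded Borel function $g:\mathbf C\to\mathbf C$ the operator $\int g\,d\Pi$ solves the equation if and only if $g=f$ $\Pi$-almost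 everywhere on $\{f_u+f_w\ne 0\}$; 2. $F$ vanishes on $\ker(\mathscr K_u+\mathscr K_w)$, and it is the only solution in the bounded functional calculus of $\Pi$ that does; 3. $F$ is the only solution in the bounded functional calculus of $\Pi$ if and only if $\mathscr K_u+\mathscr K_w$ is injective. -/

import Mathlib

open MeasureTheory Set
open scoped SchwartzMap Distributions InnerProductSpace ENNReal

noncomputable section

/-! ### Tempered generalized stochastic processes and their covariance operators -/

/-- Complex conjugation `φ ↦ φ̄` on the Schwartz space of `ℝᵈ`. -/
def schwartzConj (d : ℕ) :
    𝓢(EuclideanSpace ℝ (Fin d), ℂ) →L[ℝ] 𝓢(EuclideanSpace ℝ (Fin d), ℂ) :=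
  SchwartzMap.postcompCLM (Complex.conjCLE : ℂ →L[ℝ] ℂ)

/-- A tempered second order zero mean generalized stochastic process on `ℝᵈ`: a conjugate linear
continuous map `φ ↦ (u, φ)` from the Schwartz space to the space `L²₀(Ω)` of square integrable
random variables with expectation zero. -/
structure TemperedGSP (d : ℕ) {Ω : Type*} [MeasurableSpace Ω] (P : Measure Ω) where
  /-- the map `φ ↦ (u, φ)` -/
  pair : 𝓢(EuclideanSpace ℝ (Fin d), ℂ) →L⋆[ℂ] Lp ℂ 2 P
  /-- the random variables `(u, φ)` have zero mean -/
  zero_mean : ∀ φ, ∫ ω, pair φ ω ∂P = 0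

namespace TemperedGSP

variable {d : ℕ} {Ω : Type*} [MeasurableSpace Ω] {P : Measure Ω}

/-- The cross-covariance operator `K_{uv} : 𝓢(ℝᵈ) → 𝓢'(ℝᵈ)`, determined by
`(K_{uv} ψ, φ) = E ((u, φ) * conj (v, ψ))`. Here `(T, φ)` is the conjugate linear action of a
distribution, that is `(T, φ) = T (φ̄)` for the linear functional `T`; and `⟪Y, X⟫_ℂ` is
`E (X * conj Y)` in `L²(Ω)`. -/
def crossCovarianceOperator (u v : TemperedGSP d P) :
    𝓢(EuclideanSpace ℝ (Fin d), ℂ) →ₗ[ℂ] 𝓢'(EuclideanSpace ℝ (Fin d), ℂ) where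
  toFun ψ := ContinuousLinearMap.toPointwiseConvergenceCLM _ _ _ _
    { toFun := fun φ => ⟪v.pair ψ, u.pair (schwartzConj d φ)⟫_ℂ
      map_add' := fun φ₁ φ₂ => by simp [inner_add_right]
      map_smul' := fun c φ => by
        have h : schwartzConj d (c • φ) = (starRingEnd ℂ c) • schwartzConj d φ := by
          ext x; simp [schwartzConj]
        simp [h, inner_smul_right]
      cont := by
        have h1 : Continuous fun φ => u.pair (schwartzConj d φ) :=
          u.pair.continuous.comp (schwartzConj d).continuous
        exact continuous_const.inner h1 }
  map_add' ψ₁ ψ₂ := by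
    ext φ
    change ⟪v.pair (ψ₁ + ψ₂), _⟫_ℂ = ⟪v.pair ψ₁, _⟫_ℂ + ⟪v.pair ψ₂, _⟫_ℂ
    rw [map_add, inner_add_left]
  map_smul' c ψ := by
    ext φ
    change ⟪v.pair (c • ψ), _⟫_ℂ = c * ⟪v.pair ψ, _⟫_ℂ
    rw [map_smulₛₗ, inner_smul_left, Complex.conj_conj]

/-- The (auto-)covariance operator `K_u = K_{uu}`. -/
def covarianceOperator (u : TemperedGSP d P) :
    𝓢(EuclideanSpace ℝ (Fin d), ℂ) →ₗ[ℂ] 𝓢'(EuclideanSpace ℝ (Fin d), ℂ) :=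
  crossCovarianceOperator u u

/-- `u` and `v` are uncorrelated: their cross-covariance vanishes. -/
def Uncorrelated (u v : TemperedGSP d P) : Prop :=
  crossCovarianceOperator u v = 0

end TemperedGSP

/-! ### Hilbert spaces of distributions -/

/-- A real valued test function on `ℝᵈ`, as a Schwartz function. -/
def testToSchwartz (d : ℕ)
    (φ : 𝓓((⊤ : TopologicalSpace.Opens (EuclideanSpace ℝ (Fin d))), ℝ)) :
    𝓢(EuclideanSpace ℝ (Fin d), ℂ) :=
  HasCompactSupport.toSchwartzMap (f := fun x => (φ x : ℂ))
    (φ.hasCompactSupport.comp_left (g := fun t : ℝ => (t : ℂ)) Complex.ofReal_zero)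
    (Complex.ofRealCLM.contDiff.comp φ.contDiff)

/-- The distribution `T` on `ℝᵈ` is (the restriction to test functions of) the tempered
distribution `S`. Complex distributions are determined by their values on real test functions. -/
def IsTemperedAs {d : ℕ}
    (T : 𝓓'((⊤ : TopologicalSpace.Opens (EuclideanSpace ℝ (Fin d))), ℂ))
    (S : 𝓢'(EuclideanSpace ℝ (Fin d), ℂ)) : Prop :=
  ∀ φ, T φ = S (testToSchwartz d φ)

/-- The data that make a Hilbert space `H` a space of distributions on `ℝᵈ`: an injective
continuous linear map (inclusion) into the space of distributions. -/
structure DistributionInclusion (d : ℕ) (H : Type*) [NormedAddCommGroup H]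
    [InnerProductSpace ℂ H] where
  /-- the inclusion -/
  incl : H →L[ℂ] 𝓓'((⊤ : TopologicalSpace.Opens (EuclideanSpace ℝ (Fin d))), ℂ)
  injective : Function.Injective incl

/-- The bounded operator `A` on the space of distributions `H` is the covariance operator of `u`
acting on `H`: for each Schwartz function `ψ` which belongs to `H`, as the element `h`, the
distribution `A h` is `K_u ψ`. -/
def DistributionInclusion.IsCovariance {d : ℕ} {H : Type*} [NormedAddCommGroup H]
    [InnerProductSpace ℂ H] (J : DistributionInclusion d H)
    {Ω : Type*} [MeasurableSpace Ω] {P : Measure Ω} (u : TemperedGSP d P) (A : H →L[ℂ] H) : Prop :=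
  ∀ (ψ : 𝓢(EuclideanSpace ℝ (Fin d), ℂ)) (h : H),
    IsTemperedAs (J.incl h) (ψ : 𝓢'(EuclideanSpace ℝ (Fin d), ℂ)) →
      IsTemperedAs (J.incl (A h)) (u.covarianceOperator ψ)

/-! ### Projection-valued measures and their bounded functional calculus -/

/-- A (normalized) projection-valued measure on a measurable space `X`, with values in the
orthogonal projections of the Hilbert space `H`, countably additive in the strong operator
topology. Only the values on measurable sets matter. Multiplicativity is a consequence of
additivity, since a sum of two projections which is a projection has orthogonal summands. -/
structure ProjectionValuedMeasure (X : Type*) [MeasurableSpace X] (H : Type*)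
    [NormedAddCommGroup H] [InnerProductSpace ℂ H] [CompleteSpace H] where
  /-- the projection of a set -/
  proj : Set X → (H →L[ℂ] H)
  isStarProjection : ∀ s, MeasurableSet s → IsStarProjection (proj s)
  proj_empty : proj ∅ = 0
  proj_univ : proj univ = 1
  hasSum_iUnion : ∀ s : ℕ → Set X, (∀ n, MeasurableSet (s n)) → Pairwise (Function.onFun Disjoint s) →
    ∀ x : H, HasSum (fun n => proj (s n) x) (proj (⋃ n, s n) x)

namespace ProjectionValuedMeasure

variable {X : Type*} [MeasurableSpace X] {H : Type*} [NormedAddCommGroup H]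
  [InnerProductSpace ℂ H] [CompleteSpace H]

/-- For a projection `p` one has `⟪x, p x⟫ ≥ 0`. -/
theorem re_inner_nonneg (E : ProjectionValuedMeasure X H) {s : Set X} (hs : MeasurableSet s)
    (x : H) : 0 ≤ (⟪x, E.proj s x⟫_ℂ).re :=
  (ContinuousLinearMap.IsPositive.of_isStarProjection
    (E.isStarProjection s hs)).re_inner_nonneg_right x

/-- The non-negative scalar measure `s ↦ ⟪x, Π(s) x⟫`. -/
def scalarMeasure (E : ProjectionValuedMeasure X H) (x : H) : Measure X :=
  Measure.ofMeasurable (fun s _ => ENNReal.ofReal (⟪x, E.proj s x⟫_ℂ).re)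
    (by simp [E.proj_empty])
    (by
      intro s hs hd
      have h1 := E.hasSum_iUnion s hs hd x
      have h2 : HasSum (fun n => (⟪x, E.proj (s n) x⟫_ℂ).re)
          (⟪x, E.proj (⋃ n, s n) x⟫_ℂ).re :=
        Complex.hasSum_re (h1.mapL (innerSL ℂ x))
      rw [← h2.tsum_eq,
        ENNReal.ofReal_tsum_of_nonneg (fun n => E.re_inner_nonneg (hs n) x) h2.summable])

/-- `T = ∫ f dΠ` for a bounded measurable function `f : X → ℂ`: the bounded operator `T` is
determined by its quadratic form `⟪x, T x⟫ = ∫ f(z) ⟪x, Π(dz) x⟫`. -/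
def HasIntegral (E : ProjectionValuedMeasure X H) (f : X → ℂ) (T : H →L[ℂ] H) : Prop :=
  Measurable f ∧ (∃ C : ℝ, ∀ z, ‖f z‖ ≤ C) ∧
    ∀ x : H, ⟪x, T x⟫_ℂ = ∫ z, f z ∂(E.scalarMeasure x)

/-- The bounded functional calculus of `Π`: all operators `∫ g dΠ` with `g` bounded measurable. -/
def boundedCalculus (E : ProjectionValuedMeasure X H) : Set (H →L[ℂ] H) :=
  {T | ∃ g : X → ℂ, E.HasIntegral g T}

/-- `Π` is supported in a compact subset of `S`. -/
def IsCompactlySupportedIn [TopologicalSpace X] (E : ProjectionValuedMeasure X H) (S : Set X) :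
    Prop :=
  ∃ K : Set X, IsCompact K ∧ K ⊆ S ∧ E.proj Kᶜ = 0

end ProjectionValuedMeasure

/-- The closed first quadrant `ℂ₊` of the complex plane. -/
def closedQuadrant : Set ℂ := {z | 0 ≤ z.re ∧ 0 ≤ z.im}

/-- `f ∈ C_c(S)` for a closed set `S ⊆ ℂ`, where functions on `S` are extended by zero to `ℂ`. The
function is continuous on `S`, not necessarily across the boundary of `S`. -/
def IsCcOn (S : Set ℂ) (f : ℂ → ℝ) : Prop :=
  ContinuousOn f S ∧ HasCompactSupport f ∧ ∀ z, z ∉ S → f z = 0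

/-- The function `f_u / (f_u + f_w) · χ_{supp f_u}`. Where `f_u + f_w = 0` the quotient is read
as `0` (by `0 / 0 = 0`), so that the function vanishes wherever `f_u` does. -/
def filterFunction (fu fw : ℂ → ℝ) : ℂ → ℝ :=
  (tsupport fu).indicator fun z => fu z / (fu z + fw z)

end

/-!
The operator `A = K_u + i K_w` is bounded and normal, since `K_u` and `K_w` are self-adjoint and
commute. Its spectrum lies in the closed first quadrant, because the coordinates of a spectral value
are spectral values of the positive operators `K_u` and `K_w` (`spectrum_add_I_smul_subset`). The
spectral measure `Π` of `A` therefore represents `K_u` and `K_w` by the functions `f_u = Re z` and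
`f_w = Im z`, cut off outside the spectrum (`exists_joint_projectionValuedMeasure`).

The spectral theorem for a normal operator is derived from its continuous functional calculus `Φ`.
For every vector `x` the Riesz–Markov–Kakutani theorem gives a measure `μ_x` with
`⟪x, Φ(f) x⟫ = ∫ f dμ_x`, and `f ↦ Φ(f) x` extends to an isometry `L²(μ_x) → H` (`cyclicMap`). The
value of this isometry at a bounded Borel function `g` is `(∫ g dΠ) x`. It is linear in `x`, as one
continuous function approximates `g` in `L²(μ_x)`, `L²(μ_y)` and `L²(μ_{x+y})` at the same time
(`exists_norm_cyclicMap_sub_le`); multiplicativity (`star_borelOperator_mul`) holds because the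
isometries preserve inner products and operators are determined by their quadratic forms.

In the calculus `‖(∫ k dΠ) x‖² = ∫ |k|² dμ_x`, so that `∫ k dΠ` and the projection `Π({k ≠ 0})`
have the same kernel (`HasBorelCalculus.apply_eq_zero_iff`). With the residual
`k = f_u - g (f_u + f_w)`, which is non-zero exactly where `f_u + f_w ≠ 0` and `g` differs from the
filter function, this is the description of the solutions (`filter_equation_iff`). With
`k = f_u + f_w` it shows that `F` vanishes on the kernel of `K = K_u + K_w`. The difference `D` of
two solutions which vanish on that kernel satisfies `D K = 0`, so `K D⋆ = 0` and `D D⋆ = 0`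
(`eq_zero_of_mul_eq_zero_of_ker`). Finally `F + Π({f_u + f_w = 0})` is a solution too, and it is
different from `F` unless `K` is injective.
-/

noncomputable section

/-! ### Spectral measures and cyclic subspaces of a representation of `C(X)` -/

section Representation

variable {X : Type*} [MetricSpace X] {H : Type*} [NormedAddCommGroup H] [InnerProductSpace ℂ H]
  [CompleteSpace H] (Φ : C(X, ℂ) →⋆ₐ[ℂ] (H →L[ℂ] H))

theorem inner_map_apply_map_apply (f g : C(X, ℂ)) (x : H) :
    ⟪Φ f x, Φ g x⟫_ℂ = ⟪x, Φ (star f * g) x⟫_ℂ := by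
  rw [map_mul, map_star, ContinuousLinearMap.star_eq_adjoint, mul_apply_eq_comp,
    ContinuousLinearMap.adjoint_inner_right]

/-- The real valued function `f` as a complex valued one. -/
def complexify (f : C(X, ℝ)) : C(X, ℂ) := ⟨fun z => (f z : ℂ), by fun_prop⟩

/-- `⟪x, Φ(f) x⟫ ≥ 0` for `f ≥ 0`, because `Φ(f) = Φ(√f)⋆ Φ(√f)`. -/
theorem re_inner_map_nonneg (x : H) (f : C(X, ℝ)) (hf : 0 ≤ f) :
    0 ≤ (⟪x, Φ (complexify f) x⟫_ℂ).re := by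
  set s : C(X, ℂ) := complexify ⟨fun z => Real.sqrt (f z), by fun_prop⟩
  have hs : complexify f = star s * s := by
    ext z
    simp only [complexify, ContinuousMap.coe_mk, ContinuousMap.mul_apply, ContinuousMap.star_apply,
      s, RCLike.star_def, Complex.conj_ofReal]
    rw [← Complex.ofReal_mul]
    exact congrArg _ (Real.mul_self_sqrt (hf z)).symm
  rw [hs, ← inner_map_apply_map_apply]
  exact inner_self_nonneg (𝕜 := ℂ)

theorem im_inner_map_complexify (x : H) (f : C(X, ℝ)) :
    (⟪x, Φ (complexify f) x⟫_ℂ).im = 0 := by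
  have h : star (complexify f) = complexify f := by ext z; simp [complexify]
  have h1 : IsSelfAdjoint (Φ (complexify f)) := by
    rw [IsSelfAdjoint, ← map_star, h]
  exact (ContinuousLinearMap.isSelfAdjoint_iff_isSymmetric.1 h1).im_inner_self_apply x

variable [CompactSpace X] [MeasurableSpace X] [BorelSpace X]

/-- The functional `f ↦ ⟪x, Φ(f) x⟫` on real valued functions. -/
def spectralFunctional (x : H) : CompactlySupportedContinuousMap X ℝ →ₚ[ℝ] ℝ :=
  PositiveLinearMap.mk₀
    { toFun := fun f => (⟪x, Φ (complexify (f : C(X, ℝ))) x⟫_ℂ).re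
      map_add' := fun f g => by
        have h : complexify ((f + g : CompactlySupportedContinuousMap X ℝ) : C(X, ℝ))
          = complexify (f : C(X, ℝ)) + complexify (g : C(X, ℝ)) := by
            ext z; simp [complexify]
        rw [h]; simp
      map_smul' := fun c f => by
        have h : complexify ((c • f : CompactlySupportedContinuousMap X ℝ) : C(X, ℝ))
          = (c : ℂ) • complexify (f : C(X, ℝ)) := by
            ext z; simp [complexify]
        rw [h, map_smul]; simp }
    (fun f hf => re_inner_map_nonneg Φ x f hf)

/-- The spectral measure `μ_x` of the vector `x`, which represents `f ↦ ⟪x, Φ(f) x⟫`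
on `C(X)` by the Riesz–Markov–Kakutani theorem. -/
def spectralMeasure (x : H) : Measure X :=
  RealRMK.rieszMeasure (spectralFunctional Φ x)

instance (x : H) : IsFiniteMeasure (spectralMeasure Φ x) := by
  unfold spectralMeasure; infer_instance

theorem integral_spectralMeasure_real (x : H) (f : C(X, ℝ)) :
    ⟪x, Φ (complexify f) x⟫_ℂ = ((∫ z, f z ∂spectralMeasure Φ x : ℝ) : ℂ) := by
  have h := RealRMK.integral_rieszMeasure (spectralFunctional Φ x)
    ⟨f, HasCompactSupport.of_compactSpace _⟩
  apply Complex.ext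
  · rw [Complex.ofReal_re]; exact h.symm
  · rw [im_inner_map_complexify, Complex.ofReal_im]

theorem integral_spectralMeasure (x : H) (f : C(X, ℂ)) :
    ∫ z, f z ∂spectralMeasure Φ x = ⟪x, Φ f x⟫_ℂ := by
  set a : C(X, ℝ) := ⟨fun z => (f z).re, by fun_prop⟩
  set b : C(X, ℝ) := ⟨fun z => (f z).im, by fun_prop⟩
  have h : f = complexify a + Complex.I • complexify b := by
    ext z
    simp only [complexify, a, b, ContinuousMap.add_apply, ContinuousMap.smul_apply,
      ContinuousMap.coe_mk, smul_eq_mul]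
    rw [mul_comm, Complex.re_add_im]
  have hi : Integrable f (spectralMeasure Φ x) :=
    f.continuous.integrable_of_hasCompactSupport (HasCompactSupport.of_compactSpace _)
  conv_rhs => rw [h]
  rw [map_add, map_smul, add_apply, inner_add_right,
    smul_apply, inner_smul_right, integral_spectralMeasure_real,
    integral_spectralMeasure_real, ← integral_re_add_im hi]
  simp [a, b, mul_comm]

theorem inner_toLp (μ : Measure X) [IsFiniteMeasure μ] (f g : C(X, ℂ)) :
    ⟪f.toLp 2 μ ℂ, g.toLp 2 μ ℂ⟫_ℂ = ∫ z, (star f * g) z ∂μ := by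
  rw [ContinuousMap.inner_toLp]
  refine integral_congr_ae (Filter.Eventually.of_forall fun z => ?_)
  simp [mul_comm]

/-- The isometric embedding `L²(μ_x) → H` which sends (the class of) a continuous function `f` to
`Φ(f) x`; its range is the cyclic subspace of `x`. -/
def cyclicMap (x : H) : Lp ℂ 2 (spectralMeasure Φ x) →L[ℂ] H :=
  LinearMap.extendOfNorm
    { toFun := fun f => Φ f x
      map_add' := fun f g => by simp
      map_smul' := fun c f => by simp }
    (ContinuousMap.toLp 2 (spectralMeasure Φ x) ℂ : C(X, ℂ) →L[ℂ] _).toLinearMap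

theorem norm_map_apply (x : H) (f : C(X, ℂ)) :
    ‖Φ f x‖ = ‖f.toLp 2 (spectralMeasure Φ x) ℂ‖ := by
  rw [@norm_eq_sqrt_re_inner ℂ, @norm_eq_sqrt_re_inner ℂ, inner_toLp, integral_spectralMeasure,
    inner_map_apply_map_apply]

theorem cyclicMap_toLp (x : H) (f : C(X, ℂ)) :
    cyclicMap Φ x (f.toLp 2 (spectralMeasure Φ x) ℂ) = Φ f x :=
  LinearMap.extendOfNorm_eq (e := (ContinuousMap.toLp 2 (spectralMeasure Φ x) ℂ :
      C(X, ℂ) →L[ℂ] _).toLinearMap)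
    (ContinuousMap.toLp_denseRange ℂ (spectralMeasure Φ x) ℂ (by simp))
    ⟨1, fun f => by rw [one_mul]; exact (norm_map_apply Φ x f).le⟩ f

theorem norm_cyclicMap (x : H) (a : Lp ℂ 2 (spectralMeasure Φ x)) : ‖cyclicMap Φ x a‖ = ‖a‖ := by
  have h : DenseRange (ContinuousMap.toLp 2 (spectralMeasure Φ x) ℂ : C(X, ℂ) →L[ℂ] _) :=
    ContinuousMap.toLp_denseRange ℂ (spectralMeasure Φ x) ℂ (by simp)
  refine h.induction_on a (isClosed_eq (by fun_prop) (by fun_prop)) fun f => ?_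
  rw [cyclicMap_toLp, norm_map_apply]

theorem inner_cyclicMap (x : H) (a b : Lp ℂ 2 (spectralMeasure Φ x)) :
    ⟪cyclicMap Φ x a, cyclicMap Φ x b⟫_ℂ = ⟪a, b⟫_ℂ :=
  (⟨(cyclicMap Φ x).toLinearMap, norm_cyclicMap Φ x⟩ :
    Lp ℂ 2 (spectralMeasure Φ x) →ₗᵢ[ℂ] H).inner_map_map a b

end Representation

/-! ### Bounded measurable functions and quadratic forms of operators -/

/-- Bounded measurable complex functions, the integrands of projection-valued measures. -/
def IsBoundedMeasurable {X : Type*} [MeasurableSpace X] (g : X → ℂ) : Prop :=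
  Measurable g ∧ ∃ C : ℝ, ∀ z, ‖g z‖ ≤ C

namespace IsBoundedMeasurable

variable {X : Type*} [MeasurableSpace X] {f g : X → ℂ}

theorem memLp (hg : IsBoundedMeasurable g) (p : ℝ≥0∞) (μ : Measure X) [IsFiniteMeasure μ] :
    MemLp g p μ := by
  obtain ⟨hm, C, hC⟩ := hg
  exact MemLp.of_bound hm.aestronglyMeasurable C (Filter.Eventually.of_forall hC)

theorem integrable (hg : IsBoundedMeasurable g) (μ : Measure X) [IsFiniteMeasure μ] :
    Integrable g μ :=
  memLp_one_iff_integrable.1 (hg.memLp 1 μ)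

theorem add (hf : IsBoundedMeasurable f) (hg : IsBoundedMeasurable g) :
    IsBoundedMeasurable (fun z => f z + g z) := by
  obtain ⟨hm, C, hC⟩ := hf
  obtain ⟨hm', C', hC'⟩ := hg
  exact ⟨hm.add hm', C + C', fun z => (norm_add_le _ _).trans (add_le_add (hC z) (hC' z))⟩

theorem sub (hf : IsBoundedMeasurable f) (hg : IsBoundedMeasurable g) :
    IsBoundedMeasurable (fun z => f z - g z) := by
  obtain ⟨hm, C, hC⟩ := hf
  obtain ⟨hm', C', hC'⟩ := hg
  exact ⟨hm.sub hm', C + C', fun z => (norm_sub_le _ _).trans (add_le_add (hC z) (hC' z))⟩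

theorem mul (hf : IsBoundedMeasurable f) (hg : IsBoundedMeasurable g) :
    IsBoundedMeasurable (fun z => f z * g z) := by
  obtain ⟨hm, C, hC⟩ := hf
  obtain ⟨hm', C', hC'⟩ := hg
  refine ⟨hm.mul hm', C * C', fun z => ?_⟩
  rw [norm_mul]
  exact mul_le_mul (hC z) (hC' z) (norm_nonneg _) ((norm_nonneg _).trans (hC z))

theorem star (hf : IsBoundedMeasurable f) :
    IsBoundedMeasurable (fun z => starRingEnd ℂ (f z)) := by
  obtain ⟨hm, C, hC⟩ := hf
  exact ⟨Complex.continuous_conj.measurable.comp hm, C, fun z => by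
    rw [RCLike.norm_conj]; exact hC z⟩

theorem indicator_one {s : Set X} (hs : MeasurableSet s) :
    IsBoundedMeasurable (s.indicator (1 : X → ℂ)) := by
  refine ⟨measurable_one.indicator hs, 1, fun z => ?_⟩
  refine (norm_indicator_le_norm_self _ _).trans ?_
  simp

end IsBoundedMeasurable

theorem integral_indicator_one_complex {X : Type*} [MeasurableSpace X] (μ : Measure X) {s : Set X}
    (hs : MeasurableSet s) : ∫ z, s.indicator (1 : X → ℂ) z ∂μ = (μ.real s : ℂ) := by
  rw [integral_indicator hs]
  simp

section Operators

variable {H : Type*} [NormedAddCommGroup H] [InnerProductSpace ℂ H]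

/-- A bounded operator on a complex Hilbert space is determined by its quadratic form. -/
theorem ContinuousLinearMap.ext_inner_right_self {S T : H →L[ℂ] H}
    (h : ∀ x, ⟪x, S x⟫_ℂ = ⟪x, T x⟫_ℂ) : S = T := by
  refine ContinuousLinearMap.coe_injective ((ext_inner_map _ _).1 fun x => ?_)
  have := congrArg (starRingEnd ℂ) (h x)
  rw [inner_conj_symm, inner_conj_symm] at this
  exact this

theorem IsStarProjection.norm_sq_apply [CompleteSpace H] {p : H →L[ℂ] H}
    (hp : IsStarProjection p) (x : H) :
    ((‖p x‖ ^ 2 : ℝ) : ℂ) = ⟪x, p x⟫_ℂ := by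
  rw [Complex.ofReal_pow, ← Complex.coe_algebraMap, ← inner_self_eq_norm_sq_to_K (𝕜 := ℂ),
    ← ContinuousLinearMap.adjoint_inner_right, ← ContinuousLinearMap.star_eq_adjoint,
    hp.isSelfAdjoint.star_eq, ← mul_apply_eq_comp, hp.isIdempotentElem.eq]

end Operators

/-! ### The Borel functional calculus of a representation of `C(X)` -/

section Representation

variable {X : Type*} [MetricSpace X] {H : Type*} [NormedAddCommGroup H] [InnerProductSpace ℂ H]
  [CompleteSpace H] (Φ : C(X, ℂ) →⋆ₐ[ℂ] (H →L[ℂ] H))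
  [CompactSpace X] [MeasurableSpace X] [BorelSpace X]

theorem ContinuousMap.isBoundedMeasurable (f : C(X, ℂ)) : IsBoundedMeasurable f :=
  ⟨f.continuous.measurable, ‖f‖, f.norm_coe_le_norm⟩

theorem ContinuousMap.toLp_eq_memLp_toLp (μ : Measure X) [IsFiniteMeasure μ] (f : C(X, ℂ)) :
    f.toLp 2 μ ℂ = (f.isBoundedMeasurable.memLp 2 μ).toLp f :=
  Lp.ext ((ContinuousMap.coeFn_toLp (𝕜 := ℂ) μ f).trans (MemLp.coeFn_toLp _).symm)

/-- The vectors `∫ g dΠ x` can be approximated by `Φ(f) x` with one continuous `f` for all `x`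
whose spectral measures lie below a given measure. This is what makes them depend linearly
on `x`, although the space `L²(μ_x)` changes with `x`. -/
theorem exists_norm_cyclicMap_sub_le {g : X → ℂ} (hg : IsBoundedMeasurable g) (μ : Measure X)
    [IsFiniteMeasure μ] {ε : ℝ} (hε : 0 < ε) :
    ∃ f : C(X, ℂ), ∀ x, spectralMeasure Φ x ≤ μ →
      ‖cyclicMap Φ x ((hg.memLp 2 _).toLp g) - Φ f x‖ ≤ ε := by
  obtain ⟨f, hf, -⟩ := (hg.memLp 2 μ).exists_boundedContinuous_eLpNorm_sub_le (by simp)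
    (ENNReal.ofReal_pos.2 hε).ne'
  refine ⟨f.toContinuousMap, fun x hx => ?_⟩
  rw [← cyclicMap_toLp, ← map_sub, norm_cyclicMap, ContinuousMap.toLp_eq_memLp_toLp,
    ← MemLp.toLp_sub, Lp.norm_toLp]
  exact ENNReal.toReal_le_of_le_ofReal hε.le ((eLpNorm_mono_measure _ hx).trans hf)

theorem cyclicMap_add {g : X → ℂ} (hg : IsBoundedMeasurable g) (x y : H) :
    cyclicMap Φ (x + y) ((hg.memLp 2 _).toLp g) =
      cyclicMap Φ x ((hg.memLp 2 _).toLp g) + cyclicMap Φ y ((hg.memLp 2 _).toLp g) := by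
  refine eq_of_forall_dist_le fun ε hε => ?_
  obtain ⟨f, hf⟩ := exists_norm_cyclicMap_sub_le Φ hg
    (spectralMeasure Φ (x + y) + (spectralMeasure Φ x + spectralMeasure Φ y))
    (ε := ε / 3) (by positivity)
  have h1 := hf (x + y) (Measure.le_add_right le_rfl)
  have h2 := hf x (Measure.le_add_left (Measure.le_add_right le_rfl))
  have h3 := hf y (Measure.le_add_left (Measure.le_add_left le_rfl))
  rw [map_add, ← dist_eq_norm] at h1
  rw [← dist_eq_norm] at h2 h3
  calc _ ≤ _ := dist_triangle_right _ _ (Φ f x + Φ f y)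
    _ ≤ ε / 3 + (ε / 3 + ε / 3) :=
        add_le_add h1 ((dist_add_add_le _ _ _ _).trans (add_le_add h2 h3))
    _ = ε := by ring

theorem cyclicMap_smul {g : X → ℂ} (hg : IsBoundedMeasurable g) (c : ℂ) (x : H) :
    cyclicMap Φ (c • x) ((hg.memLp 2 _).toLp g) =
      c • cyclicMap Φ x ((hg.memLp 2 _).toLp g) := by
  refine eq_of_forall_dist_le fun ε hε => ?_
  obtain ⟨f, hf⟩ := exists_norm_cyclicMap_sub_le Φ hg
    (spectralMeasure Φ (c • x) + spectralMeasure Φ x) (ε := ε / (1 + ‖c‖)) (by positivity)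
  have h1 := hf (c • x) (Measure.le_add_right le_rfl)
  have h2 := hf x (Measure.le_add_left le_rfl)
  rw [map_smul, ← dist_eq_norm] at h1
  rw [← dist_eq_norm] at h2
  calc _ ≤ _ := dist_triangle_right _ _ (c • Φ f x)
    _ ≤ ε / (1 + ‖c‖) + ‖c‖ * (ε / (1 + ‖c‖)) := by
        rw [dist_smul₀]; gcongr
    _ = ε := by field_simp

/-- The spectral measure of `x` has mass `‖x‖²`, the squared norm of `1` in `L²(μ_x)`. -/
theorem norm_cyclicMap_le {g : X → ℂ} (hg : IsBoundedMeasurable g) {C : ℝ}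
    (hC : ∀ z, ‖g z‖ ≤ C) (x : H) :
    ‖cyclicMap Φ x ((hg.memLp 2 _).toLp g)‖ ≤ C * ‖x‖ := by
  have h1 : ‖x‖ = ‖(1 : C(X, ℂ)).toLp 2 (spectralMeasure Φ x) ℂ‖ := by
    rw [← norm_map_apply, map_one, one_apply_eq_self]
  rw [norm_cyclicMap, h1]
  refine Lp.norm_le_mul_norm_of_ae_le_mul ?_
  filter_upwards [(hg.memLp 2 (spectralMeasure Φ x)).coeFn_toLp,
    ContinuousMap.coeFn_toLp (p := 2) (𝕜 := ℂ) (spectralMeasure Φ x) (1 : C(X, ℂ))] with z hz hz'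
  rw [hz, hz']
  simpa using hC z

/-- The operator `∫ g dΠ` of the Borel functional calculus extending `Φ`, for bounded
measurable `g`. -/
def borelOperator {g : X → ℂ} (hg : IsBoundedMeasurable g) : H →L[ℂ] H :=
  LinearMap.mkContinuousOfExistsBound
    { toFun := fun x => cyclicMap Φ x ((hg.memLp 2 _).toLp g)
      map_add' := cyclicMap_add Φ hg
      map_smul' := cyclicMap_smul Φ hg }
    (hg.2.imp fun _ hC => norm_cyclicMap_le Φ hg hC)

theorem borelOperator_apply {g : X → ℂ} (hg : IsBoundedMeasurable g) (x : H) :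
    borelOperator Φ hg x = cyclicMap Φ x ((hg.memLp 2 _).toLp g) := rfl

theorem borelOperator_continuousMap (f : C(X, ℂ)) :
    borelOperator Φ f.isBoundedMeasurable = Φ f := by
  ext x
  rw [borelOperator_apply, ← ContinuousMap.toLp_eq_memLp_toLp, cyclicMap_toLp]

theorem inner_borelOperator_borelOperator {f g : X → ℂ} (hf : IsBoundedMeasurable f)
    (hg : IsBoundedMeasurable g) (x : H) :
    ⟪borelOperator Φ hf x, borelOperator Φ hg x⟫_ℂ =
      ∫ z, starRingEnd ℂ (f z) * g z ∂spectralMeasure Φ x := by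
  rw [borelOperator_apply, borelOperator_apply, inner_cyclicMap, MeasureTheory.L2.inner_def]
  refine integral_congr_ae ?_
  filter_upwards [(hf.memLp 2 (spectralMeasure Φ x)).coeFn_toLp,
    (hg.memLp 2 (spectralMeasure Φ x)).coeFn_toLp] with z hz hz'
  rw [hz, hz', RCLike.inner_apply, mul_comm]

theorem inner_borelOperator {g : X → ℂ} (hg : IsBoundedMeasurable g) (x : H) :
    ⟪x, borelOperator Φ hg x⟫_ℂ = ∫ z, g z ∂spectralMeasure Φ x := by
  have h := inner_borelOperator_borelOperator Φ (1 : C(X, ℂ)).isBoundedMeasurable hg x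
  rw [borelOperator_continuousMap, map_one, one_apply_eq_self] at h
  simpa using h

/-- The Borel functional calculus is multiplicative: both sides have the same quadratic form, since
`cyclicMap` preserves inner products. -/
theorem star_borelOperator_mul {f g : X → ℂ} (hf : IsBoundedMeasurable f)
    (hg : IsBoundedMeasurable g) :
    star (borelOperator Φ hf) * borelOperator Φ hg = borelOperator Φ (hf.star.mul hg) := by
  refine ContinuousLinearMap.ext_inner_right_self fun x => ?_
  rw [inner_borelOperator, mul_apply_eq_comp, ContinuousLinearMap.star_eq_adjoint,
    ContinuousLinearMap.adjoint_inner_right, inner_borelOperator_borelOperator]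

/-- The spectral projection `Π(s)`; it is `0` for non-measurable `s`. -/
def spectralProjection (s : Set X) : H →L[ℂ] H :=
  open scoped Classical in
  if hs : MeasurableSet s then borelOperator Φ (IsBoundedMeasurable.indicator_one hs) else 0

theorem spectralProjection_of_measurableSet {s : Set X} (hs : MeasurableSet s) :
    spectralProjection Φ s = borelOperator Φ (IsBoundedMeasurable.indicator_one hs) :=
  dif_pos hs

theorem isStarProjection_spectralProjection {s : Set X} (hs : MeasurableSet s) :
    IsStarProjection (spectralProjection Φ s) := by
  rw [spectralProjection_of_measurableSet Φ hs]
  set p := borelOperator Φ (IsBoundedMeasurable.indicator_one hs)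
  -- `𝟙_s` is its own modulus squared, so `p` is equal to `p⋆ p`
  have h : star p * p = p := by
    rw [star_borelOperator_mul]
    congr 1
    ext z
    by_cases hz : z ∈ s <;> simp [hz]
  have hsa : star p = p := by
    conv_lhs => rw [← h]
    rw [star_mul, star_star, h]
  exact ⟨by rw [IsIdempotentElem]; rwa [hsa] at h, hsa⟩

theorem inner_spectralProjection {s : Set X} (hs : MeasurableSet s) (x : H) :
    ⟪x, spectralProjection Φ s x⟫_ℂ = ((spectralMeasure Φ x).real s : ℂ) := by
  rw [spectralProjection_of_measurableSet Φ hs, inner_borelOperator, integral_indicator_one_complex _ hs]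

theorem spectralProjection_disjoint_union {s t : Set X} (hs : MeasurableSet s)
    (ht : MeasurableSet t) (hd : Disjoint s t) :
    spectralProjection Φ (s ∪ t) = spectralProjection Φ s + spectralProjection Φ t := by
  refine ContinuousLinearMap.ext_inner_right_self fun x => ?_
  rw [inner_spectralProjection Φ (hs.union ht), add_apply, inner_add_right,
    inner_spectralProjection Φ hs, inner_spectralProjection Φ ht, measureReal_union hd ht,
    Complex.ofReal_add]

theorem spectralProjection_biUnion {s : ℕ → Set X} (hs : ∀ n, MeasurableSet (s n))
    (hd : Pairwise (Function.onFun Disjoint s)) (F : Finset ℕ) :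
    spectralProjection Φ (⋃ n ∈ F, s n) = ∑ n ∈ F, spectralProjection Φ (s n) := by
  refine ContinuousLinearMap.ext_inner_right_self fun x => ?_
  rw [inner_spectralProjection Φ (Finset.measurableSet_biUnion F fun n _ => hs n),
    measureReal_biUnion_finset (fun i _ j _ hij => hd hij) (fun n _ => hs n)]
  simp [inner_spectralProjection Φ (hs _)]

/-- Countable additivity of the spectral projections, in the strong operator topology. -/
theorem hasSum_spectralProjection {s : ℕ → Set X} (hs : ∀ n, MeasurableSet (s n))
    (hd : Pairwise (Function.onFun Disjoint s)) (x : H) :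
    HasSum (fun n => spectralProjection Φ (s n) x) (spectralProjection Φ (⋃ n, s n) x) := by
  set μ := spectralMeasure Φ x
  have hμ : HasSum (fun n => μ.real (s n)) (μ.real (⋃ n, s n)) := by
    have h := ENNReal.hasSum_toReal (f := fun n => μ (s n))
      (by rw [← measure_iUnion hd hs]; exact measure_ne_top _ _)
    rwa [← ENNReal.tsum_toReal_eq (fun n => measure_ne_top _ _), ← measure_iUnion hd hs] at h
  -- the remainder of a partial sum is the projection of the remaining union
  have hrem : ∀ F : Finset ℕ, ‖∑ n ∈ F, spectralProjection Φ (s n) x -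
      spectralProjection Φ (⋃ n, s n) x‖ ^ 2 = μ.real (⋃ n, s n) - ∑ n ∈ F, μ.real (s n) := by
    intro F
    have hF : MeasurableSet (⋃ n ∈ F, s n) := Finset.measurableSet_biUnion F fun n _ => hs n
    have hsub : (⋃ n ∈ F, s n) ⊆ ⋃ n, s n := iUnion₂_subset fun n _ => subset_iUnion s n
    have hR : MeasurableSet ((⋃ n, s n) \ ⋃ n ∈ F, s n) := (MeasurableSet.iUnion hs).diff hF
    have h1 := spectralProjection_disjoint_union Φ hF hR disjoint_sdiff_right
    rw [union_sdiff_cancel hsub, spectralProjection_biUnion Φ hs hd] at h1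
    have h2 : ∑ n ∈ F, spectralProjection Φ (s n) x - spectralProjection Φ (⋃ n, s n) x =
        -spectralProjection Φ ((⋃ n, s n) \ ⋃ n ∈ F, s n) x := by
      rw [h1]; simp
    have h3 := (isStarProjection_spectralProjection Φ hR).norm_sq_apply x
    rw [inner_spectralProjection Φ hR, Complex.ofReal_inj] at h3
    rw [h2, norm_neg, h3, measureReal_sdiff hsub hF,
      measureReal_biUnion_finset (fun i _ j _ hij => hd hij) (fun n _ => hs n)]
  rw [HasSum, tendsto_iff_norm_sub_tendsto_zero]
  have h0 : Filter.Tendsto (fun F : Finset ℕ => Real.sqrt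
      (μ.real (⋃ n, s n) - ∑ n ∈ F, μ.real (s n))) Filter.atTop (nhds 0) := by
    have := (hμ.const_sub (μ.real (⋃ n, s n))).sqrt
    rwa [sub_self, Real.sqrt_zero] at this
  refine h0.congr fun F => ?_
  rw [← hrem, Real.sqrt_sq (norm_nonneg _)]

/-- The projection-valued measure which represents `Φ`. -/
def spectralPVM : ProjectionValuedMeasure X H where
  proj := spectralProjection Φ
  isStarProjection _ hs := isStarProjection_spectralProjection Φ hs
  proj_empty := ContinuousLinearMap.ext_inner_right_self fun x => by
    simp [inner_spectralProjection Φ MeasurableSet.empty]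
  proj_univ := ContinuousLinearMap.ext_inner_right_self fun x => by
    rw [inner_spectralProjection Φ MeasurableSet.univ]
    have h := integral_spectralMeasure Φ x 1
    simpa using h
  hasSum_iUnion _ hs hd x := hasSum_spectralProjection Φ hs hd x

end Representation

/-! ### Integrals with respect to a projection-valued measure -/

namespace ProjectionValuedMeasure

section

variable {X : Type*} [MeasurableSpace X] {H : Type*} [NormedAddCommGroup H]
  [InnerProductSpace ℂ H] [CompleteSpace H] (E : ProjectionValuedMeasure X H)

theorem scalarMeasure_apply (x : H) {s : Set X} (hs : MeasurableSet s) :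
    E.scalarMeasure x s = ENNReal.ofReal (⟪x, E.proj s x⟫_ℂ).re :=
  Measure.ofMeasurable_apply s hs

theorem scalarMeasure_apply_eq_norm_sq (x : H) {s : Set X} (hs : MeasurableSet s) :
    E.scalarMeasure x s = ENNReal.ofReal (‖E.proj s x‖ ^ 2) := by
  rw [E.scalarMeasure_apply x hs, ← (E.isStarProjection s hs).norm_sq_apply, Complex.ofReal_re]

instance (x : H) : IsFiniteMeasure (E.scalarMeasure x) :=
  ⟨by rw [E.scalarMeasure_apply x MeasurableSet.univ]; exact ENNReal.ofReal_lt_top⟩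

theorem scalarMeasure_eq_zero_iff (x : H) {s : Set X} (hs : MeasurableSet s) :
    E.scalarMeasure x s = 0 ↔ E.proj s x = 0 := by
  rw [E.scalarMeasure_apply_eq_norm_sq x hs, ENNReal.ofReal_eq_zero]
  constructor
  · intro h
    exact norm_eq_zero.1 (pow_eq_zero_iff two_ne_zero |>.1 (le_antisymm h (sq_nonneg _)))
  · intro h; simp [h]

variable {E}

theorem HasIntegral.isBoundedMeasurable {g : X → ℂ} {T : H →L[ℂ] H} (h : E.HasIntegral g T) :
    IsBoundedMeasurable g :=
  ⟨h.1, h.2.1⟩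

theorem HasIntegral.unique {g : X → ℂ} {S T : H →L[ℂ] H} (hS : E.HasIntegral g S)
    (hT : E.HasIntegral g T) : S = T :=
  ContinuousLinearMap.ext_inner_right_self fun x => by rw [hS.2.2, hT.2.2]

theorem HasIntegral.add {f g : X → ℂ} {S T : H →L[ℂ] H} (hS : E.HasIntegral f S)
    (hT : E.HasIntegral g T) : E.HasIntegral (fun z => f z + g z) (S + T) := by
  obtain ⟨h1, h2⟩ := hS.isBoundedMeasurable.add hT.isBoundedMeasurable
  refine ⟨h1, h2, fun x => ?_⟩
  rw [add_apply, inner_add_right, hS.2.2, hT.2.2,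
    integral_add (hS.isBoundedMeasurable.integrable _) (hT.isBoundedMeasurable.integrable _)]

theorem HasIntegral.sub {f g : X → ℂ} {S T : H →L[ℂ] H} (hS : E.HasIntegral f S)
    (hT : E.HasIntegral g T) : E.HasIntegral (fun z => f z - g z) (S - T) := by
  obtain ⟨h1, h2⟩ := hS.isBoundedMeasurable.sub hT.isBoundedMeasurable
  refine ⟨h1, h2, fun x => ?_⟩
  rw [sub_apply, inner_sub_right, hS.2.2, hT.2.2,
    integral_sub (hS.isBoundedMeasurable.integrable _) (hT.isBoundedMeasurable.integrable _)]

variable (E) in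
theorem hasIntegral_indicator_one {s : Set X} (hs : MeasurableSet s) :
    E.HasIntegral (s.indicator 1) (E.proj s) := by
  obtain ⟨h1, h2⟩ := IsBoundedMeasurable.indicator_one hs
  refine ⟨h1, h2, fun x => ?_⟩
  rw [integral_indicator_one_complex _ hs, measureReal_def, E.scalarMeasure_apply_eq_norm_sq x hs,
    ENNReal.toReal_ofReal (sq_nonneg _), (E.isStarProjection s hs).norm_sq_apply]

/-- The integral of a real non-negative function is a positive operator. -/
theorem HasIntegral.isPositive {f : X → ℝ} {T : H →L[ℂ] H}
    (hT : E.HasIntegral (fun z => (f z : ℂ)) T) (hf : ∀ z, 0 ≤ f z) : T.IsPositive := by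
  have h : ∀ x, ⟪T x, x⟫_ℂ = ((∫ z, f z ∂E.scalarMeasure x : ℝ) : ℂ) := fun x => by
    rw [← inner_conj_symm, hT.2.2, integral_complex_ofReal, Complex.conj_ofReal]
  rw [ContinuousLinearMap.isPositive_iff_complex]
  intro x
  rw [h x]
  exact ⟨by simp, by simpa using integral_nonneg hf⟩

variable (E) in
/-- Every bounded measurable function has an integral, and the integral is multiplicative and
compatible with adjoints. -/
structure HasBorelCalculus : Prop where
  exists_integral : ∀ g : X → ℂ, IsBoundedMeasurable g → ∃ T, E.HasIntegral g T
  star_mul : ∀ {f g : X → ℂ} {S T : H →L[ℂ] H}, E.HasIntegral f S → E.HasIntegral g T →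
    E.HasIntegral (fun z => starRingEnd ℂ (f z) * g z) (star S * T)

namespace HasBorelCalculus

theorem star (hE : E.HasBorelCalculus) {f : X → ℂ} {S : H →L[ℂ] H} (hS : E.HasIntegral f S) :
    E.HasIntegral (fun z => starRingEnd ℂ (f z)) (star S) := by
  -- multiplication by `1 = ∫ 1 dΠ`
  have h := hE.star_mul hS (E.hasIntegral_indicator_one MeasurableSet.univ)
  simpa [E.proj_univ] using h

theorem mul (hE : E.HasBorelCalculus) {f g : X → ℂ} {S T : H →L[ℂ] H} (hS : E.HasIntegral f S)
    (hT : E.HasIntegral g T) : E.HasIntegral (fun z => f z * g z) (S * T) := by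
  simpa using hE.star_mul (hE.star hS) hT

theorem measurableSet_ne_zero {f : X → ℂ} (hf : Measurable f) : MeasurableSet {z | f z ≠ 0} :=
  (hf (measurableSet_singleton 0)).compl

/-- The kernel of `∫ f dΠ` is the kernel of `Π({f ≠ 0})`, because
`‖(∫ f dΠ) x‖² = ∫ |f|² dμ_x`. -/
theorem apply_eq_zero_iff (hE : E.HasBorelCalculus) {f : X → ℂ} {T : H →L[ℂ] H}
    (hT : E.HasIntegral f T) (x : H) : T x = 0 ↔ E.proj {z | f z ≠ 0} x = 0 := by
  have h1 := (hE.star_mul hT hT).2.2 x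
  have h2 : ∀ z, starRingEnd ℂ (f z) * f z = ((‖f z‖ ^ 2 : ℝ) : ℂ) := fun z => by
    rw [RCLike.conj_mul]; simp
  simp_rw [h2] at h1
  rw [integral_complex_ofReal, mul_apply_eq_comp, ContinuousLinearMap.star_eq_adjoint,
    ContinuousLinearMap.adjoint_inner_right] at h1
  have hint : Integrable (fun z => ‖f z‖ ^ 2) (E.scalarMeasure x) :=
    (hT.isBoundedMeasurable.memLp 2 _).integrable_norm_pow two_ne_zero
  rw [← E.scalarMeasure_eq_zero_iff x (measurableSet_ne_zero hT.1), ← inner_self_eq_zero (𝕜 := ℂ),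
    h1, Complex.ofReal_eq_zero, integral_eq_zero_iff_of_nonneg (fun z => sq_nonneg _) hint,
    Filter.EventuallyEq, ae_iff]
  simp

theorem eq_zero_iff (hE : E.HasBorelCalculus) {f : X → ℂ} {T : H →L[ℂ] H}
    (hT : E.HasIntegral f T) : T = 0 ↔ E.proj {z | f z ≠ 0} = 0 := by
  simp only [ContinuousLinearMap.ext_iff, hE.apply_eq_zero_iff hT, zero_apply]

end HasBorelCalculus

variable (E) in
/-- The image of a projection-valued measure under a measurable map. -/
def map {Y : Type*} [MeasurableSpace Y] (φ : X → Y) (hφ : Measurable φ) :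
    ProjectionValuedMeasure Y H where
  proj s := E.proj (φ ⁻¹' s)
  isStarProjection s hs := E.isStarProjection _ (hφ hs)
  proj_empty := by rw [preimage_empty, E.proj_empty]
  proj_univ := by rw [preimage_univ, E.proj_univ]
  hasSum_iUnion s hs hd x := by
    rw [preimage_iUnion]
    exact E.hasSum_iUnion _ (fun n => hφ (hs n)) (fun i j hij => (hd hij).preimage φ) x

theorem scalarMeasure_map {Y : Type*} [MeasurableSpace Y] {φ : X → Y} (hφ : Measurable φ) (x : H) :
    (E.map φ hφ).scalarMeasure x = (E.scalarMeasure x).map φ := by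
  ext s hs
  rw [Measure.map_apply hφ hs, scalarMeasure_apply _ x hs, scalarMeasure_apply _ x (hφ hs)]
  rfl

/-- Boundedness and measurability of `g` are assumed since `g ∘ φ` says nothing about `g` outside
the range of `φ`. -/
theorem hasIntegral_map_iff {Y : Type*} [MeasurableSpace Y] {φ : X → Y} (hφ : Measurable φ)
    {g : Y → ℂ} (hg : IsBoundedMeasurable g) {T : H →L[ℂ] H} :
    (E.map φ hφ).HasIntegral g T ↔ E.HasIntegral (fun z => g (φ z)) T := by
  have h : ∀ x, ∫ z, g z ∂(E.map φ hφ).scalarMeasure x = ∫ z, g (φ z) ∂E.scalarMeasure x :=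
    fun x => by
      rw [scalarMeasure_map, integral_map hφ.aemeasurable hg.1.aestronglyMeasurable]
  simp only [HasIntegral, h]
  exact ⟨fun H => ⟨hg.1.comp hφ, hg.2.imp fun C hC z => hC _, H.2.2⟩,
    fun H => ⟨hg.1, hg.2, H.2.2⟩⟩

theorem HasBorelCalculus.map (hE : E.HasBorelCalculus) {Y : Type*} [MeasurableSpace Y] {φ : X → Y}
    (hφ : Measurable φ) : (E.map φ hφ).HasBorelCalculus where
  exists_integral g hg := by
    obtain ⟨T, hT⟩ := hE.exists_integral (fun z => g (φ z))
      ⟨hg.1.comp hφ, hg.2.imp fun C hC z => hC _⟩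
    exact ⟨T, (hasIntegral_map_iff hφ hg).2 hT⟩
  star_mul hS hT := by
    rw [hasIntegral_map_iff hφ (hS.isBoundedMeasurable.star.mul hT.isBoundedMeasurable)]
    exact hE.star_mul ((hasIntegral_map_iff hφ hS.isBoundedMeasurable).1 hS)
      ((hasIntegral_map_iff hφ hT.isBoundedMeasurable).1 hT)

end

section Representation

variable {X : Type*} [MetricSpace X] {H : Type*} [NormedAddCommGroup H] [InnerProductSpace ℂ H]
  [CompleteSpace H] (Φ : C(X, ℂ) →⋆ₐ[ℂ] (H →L[ℂ] H))
  [CompactSpace X] [MeasurableSpace X] [BorelSpace X]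

theorem scalarMeasure_spectralPVM (x : H) :
    (spectralPVM Φ).scalarMeasure x = spectralMeasure Φ x := by
  ext s hs
  rw [scalarMeasure_apply _ x hs]
  change ENNReal.ofReal (⟪x, spectralProjection Φ s x⟫_ℂ).re = _
  rw [inner_spectralProjection Φ hs, Complex.ofReal_re, ofReal_measureReal]

theorem hasIntegral_borelOperator {g : X → ℂ} (hg : IsBoundedMeasurable g) :
    (spectralPVM Φ).HasIntegral g (borelOperator Φ hg) :=
  ⟨hg.1, hg.2, fun x => by rw [scalarMeasure_spectralPVM, inner_borelOperator]⟩

theorem hasBorelCalculus_spectralPVM : (spectralPVM Φ).HasBorelCalculus where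
  exists_integral _ hg := ⟨_, hasIntegral_borelOperator Φ hg⟩
  star_mul hS hT := by
    rw [hS.unique (hasIntegral_borelOperator Φ hS.isBoundedMeasurable),
      hT.unique (hasIntegral_borelOperator Φ hT.isBoundedMeasurable), star_borelOperator_mul]
    exact hasIntegral_borelOperator Φ _

end Representation

end ProjectionValuedMeasure

/-! ### The spectral theorem for a normal operator -/

section Normal

variable {H : Type*} [NormedAddCommGroup H] [InnerProductSpace ℂ H] [CompleteSpace H]

/-- The spectral theorem for a bounded normal operator `A`: the projection-valued measure lives on
the spectrum and represents the continuous functional calculus. -/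
theorem exists_projectionValuedMeasure_of_isStarNormal (A : H →L[ℂ] H) [hA : IsStarNormal A] :
    ∃ E : ProjectionValuedMeasure ℂ H, E.HasBorelCalculus ∧ E.proj (spectrum ℂ A)ᶜ = 0 ∧
      ∀ f : ℂ → ℂ, IsBoundedMeasurable f → ContinuousOn f (spectrum ℂ A) →
        E.HasIntegral f (cfc f A) := by
  have hc : CompactSpace (spectrum ℂ A) := isCompact_iff_compactSpace.1 (spectrum.isCompact A)
  set Φ : C(spectrum ℂ A, ℂ) →⋆ₐ[ℂ] (H →L[ℂ] H) := cfcHom hA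
  have hφ : Measurable (Subtype.val : spectrum ℂ A → ℂ) := measurable_subtype_coe
  refine ⟨(spectralPVM Φ).map _ hφ,
    (ProjectionValuedMeasure.hasBorelCalculus_spectralPVM Φ).map hφ, ?_, fun f hf hfc => ?_⟩
  · change (spectralPVM Φ).proj _ = 0
    rw [preimage_compl, Subtype.coe_preimage_self, compl_univ, (spectralPVM Φ).proj_empty]
  · rw [ProjectionValuedMeasure.hasIntegral_map_iff hφ hf, cfc_apply f A hA hfc]
    have h := ProjectionValuedMeasure.hasIntegral_borelOperator Φ
      (ContinuousMap.isBoundedMeasurable ⟨(spectrum ℂ A).domRestrict f, hfc.domRestrict⟩)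
    rw [borelOperator_continuousMap] at h
    exact h

variable {S T : H →L[ℂ] H}

theorem isStarNormal_add_I_smul (hS : IsSelfAdjoint S) (hT : IsSelfAdjoint T)
    (hST : S * T = T * S) : IsStarNormal (S + Complex.I • T) := by
  refine ⟨?_⟩
  rw [commute_iff_eq, star_add, star_smul, hS.star_eq, hT.star_eq]
  simp only [RCLike.star_def, Complex.conj_I, add_mul, mul_add, smul_mul_assoc, mul_smul_comm, hST,
    neg_smul, mul_neg, neg_mul]
  module

theorem cfc_re_add_I_smul (hS : IsSelfAdjoint S) (hT : IsSelfAdjoint T)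
    [IsStarNormal (S + Complex.I • T)] :
    cfc (fun z : ℂ => (z.re : ℂ)) (S + Complex.I • T) = S := by
  have h : (fun z : ℂ => (z.re : ℂ)) = fun z => (1 / 2 : ℂ) * (z + star z) := by
    ext z
    rw [RCLike.star_def, Complex.add_conj]; push_cast; ring
  rw [h, cfc_const_mul _ _ _, cfc_add _ _ _, cfc_id' ℂ _, cfc_star _ _, cfc_id' ℂ _, star_add,
    star_smul, hS.star_eq, hT.star_eq, RCLike.star_def, Complex.conj_I]
  module

theorem cfc_im_add_I_smul (hS : IsSelfAdjoint S) (hT : IsSelfAdjoint T)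
    [IsStarNormal (S + Complex.I • T)] :
    cfc (fun z : ℂ => (z.im : ℂ)) (S + Complex.I • T) = T := by
  have h : (fun z : ℂ => (z.im : ℂ)) = fun z => (-Complex.I / 2 : ℂ) * (z - star z) := by
    ext z
    rw [RCLike.star_def, Complex.sub_conj]; push_cast; ring_nf; simp
  rw [h, cfc_const_mul _ _ _, cfc_sub _ _ _, cfc_id' ℂ _, cfc_star _ _, cfc_id' ℂ _, star_add,
    star_smul, hS.star_eq, hT.star_eq, RCLike.star_def, Complex.conj_I]
  have h2 : S + Complex.I • T - (S + -Complex.I • T) = (2 * Complex.I) • T := by module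
  rw [h2, smul_smul]
  have h3 : -Complex.I / 2 * (2 * Complex.I) = 1 := by
    ring_nf; simp
  rw [h3, one_smul]

/-- By the spectral mapping theorem the real and imaginary parts of a spectral value of `S + i T` are
spectral values of `S` and of `T`. -/
theorem spectrum_add_I_smul_subset (hS : S.IsPositive) (hT : T.IsPositive)
    [IsStarNormal (S + Complex.I • T)] : spectrum ℂ (S + Complex.I • T) ⊆ closedQuadrant := by
  intro z hz
  have hre : (z.re : ℂ) ∈ spectrum ℂ S := by
    have h := cfc_map_spectrum (R := ℂ) (fun z : ℂ => (z.re : ℂ)) (S + Complex.I • T)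
    rw [cfc_re_add_I_smul hS.isSelfAdjoint hT.isSelfAdjoint] at h
    rw [h]; exact ⟨z, hz, rfl⟩
  have him : (z.im : ℂ) ∈ spectrum ℂ T := by
    have h := cfc_map_spectrum (R := ℂ) (fun z : ℂ => (z.im : ℂ)) (S + Complex.I • T)
    rw [cfc_im_add_I_smul hS.isSelfAdjoint hT.isSelfAdjoint] at h
    rw [h]; exact ⟨z, hz, rfl⟩
  have key : ∀ {R : H →L[ℂ] H} {r : ℝ}, R.IsPositive → (r : ℂ) ∈ spectrum ℂ R → 0 ≤ r := by
    intro R r hR hr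
    refine spectrum_nonneg_of_nonneg (𝕜 := ℝ) ((ContinuousLinearMap.nonneg_iff_isPositive R).2 hR)
      ?_
    rwa [← spectrum.preimage_algebraMap ℂ]
  exact ⟨key hS hre, key hT him⟩

end Normal

theorem isClosed_closedQuadrant : IsClosed closedQuadrant :=
  (isClosed_le continuous_const Complex.continuous_re).inter
    (isClosed_le continuous_const Complex.continuous_im)

/-- A continuous function with compact support, restricted to the quadrant. -/
theorem isCcOn_indicator {f : ℂ → ℝ} (hf : Continuous f) (hc : HasCompactSupport f) :
    IsCcOn closedQuadrant (closedQuadrant.indicator f) := by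
  refine ⟨hf.continuousOn.congr fun z hz => indicator_of_mem hz f, ?_, fun z hz =>
    indicator_of_notMem hz f⟩
  refine hc.mono fun z hz => ?_
  rw [support_indicator] at hz
  exact hz.2

/-- Functions in `C_c(ℂ₊)` are bounded and Borel measurable on `ℂ`. -/
theorem IsCcOn.isBoundedMeasurable {S : Set ℂ} (hS : IsClosed S) {f : ℂ → ℝ} (hf : IsCcOn S f) :
    IsBoundedMeasurable (fun z => (f z : ℂ)) := by
  obtain ⟨h1, h2, h3⟩ := hf
  have hind : S.indicator f = f := indicator_eq_self.2 fun z hz => by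
    by_contra h
    exact hz (h3 z h)
  refine ⟨Complex.measurable_ofReal.comp ?_, ?_⟩
  · rw [← hind]
    classical
    rw [← piecewise_eq_indicator]
    exact h1.measurable_piecewise continuousOn_const hS.measurableSet
  · obtain ⟨C, hC⟩ := (h2.isCompact.inter_right hS).exists_bound_of_continuousOn
      (h1.mono inter_subset_right)
    refine ⟨max C 0, fun z => ?_⟩
    rw [Complex.norm_real]
    by_cases hz : z ∈ tsupport f ∩ S
    · exact (hC z hz).trans (le_max_left _ _)
    · have : f z = 0 := by
        by_contra h
        exact hz ⟨subset_tsupport f h, by_contra fun h' => h (h3 z h')⟩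
      simp [this]

section Joint

variable {H : Type*} [NormedAddCommGroup H] [InnerProductSpace ℂ H] [CompleteSpace H]

/-- Commuting positive operators are diagonalized by one projection-valued measure on the closed
quadrant, the spectral measure of the normal operator `S + i T`. -/
theorem exists_joint_projectionValuedMeasure {S T : H →L[ℂ] H} (hS : S.IsPositive)
    (hT : T.IsPositive) (hST : S * T = T * S) :
    ∃ (E : ProjectionValuedMeasure ℂ H) (fu fw : ℂ → ℝ), E.HasBorelCalculus ∧
      E.IsCompactlySupportedIn closedQuadrant ∧
      IsCcOn closedQuadrant fu ∧ IsCcOn closedQuadrant fw ∧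
      (∀ z, 0 ≤ fu z) ∧ (∀ z, 0 ≤ fw z) ∧
      E.HasIntegral (fun z => (fu z : ℂ)) S ∧ E.HasIntegral (fun z => (fw z : ℂ)) T := by
  have hN := isStarNormal_add_I_smul hS.isSelfAdjoint hT.isSelfAdjoint hST
  set A := S + Complex.I • T with hA
  have hsub : spectrum ℂ A ⊆ closedQuadrant := spectrum_add_I_smul_subset hS hT
  have hK : IsCompact (spectrum ℂ A) := spectrum.isCompact A
  obtain ⟨E, hE, hE0, hEint⟩ := exists_projectionValuedMeasure_of_isStarNormal A
  -- the coordinate functions are cut off by `ρ` outside the spectrum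
  obtain ⟨ρ, hρ1, -, hρc, hρ⟩ := exists_continuous_one_zero_of_isCompact hK isClosed_empty
    (disjoint_empty _)
  have hcu : IsCcOn closedQuadrant (closedQuadrant.indicator fun z => ρ z * z.re) :=
    isCcOn_indicator (by fun_prop) hρc.mul_right
  have hcw : IsCcOn closedQuadrant (closedQuadrant.indicator fun z => ρ z * z.im) :=
    isCcOn_indicator (by fun_prop) hρc.mul_right
  have hequ : EqOn (fun z => ((closedQuadrant.indicator (fun z => ρ z * z.re) z : ℝ) : ℂ))
      (fun z => (z.re : ℂ)) (spectrum ℂ A) := fun z hz => by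
    simp only [indicator_of_mem (hsub hz), hρ1 hz, Pi.one_apply, one_mul]
  have heqw : EqOn (fun z => ((closedQuadrant.indicator (fun z => ρ z * z.im) z : ℝ) : ℂ))
      (fun z => (z.im : ℂ)) (spectrum ℂ A) := fun z hz => by
    simp only [indicator_of_mem (hsub hz), hρ1 hz, Pi.one_apply, one_mul]
  refine ⟨E, _, _, hE, ⟨_, hK, hsub, hE0⟩, hcu, hcw,
    indicator_nonneg fun z hz => mul_nonneg (hρ z).1 hz.1,
    indicator_nonneg fun z hz => mul_nonneg (hρ z).1 hz.2, ?_, ?_⟩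
  · have h := hEint _ (hcu.isBoundedMeasurable isClosed_closedQuadrant)
      (ContinuousOn.congr (by fun_prop) hequ)
    rwa [cfc_congr hequ, cfc_re_add_I_smul hS.isSelfAdjoint hT.isSelfAdjoint] at h
  · have h := hEint _ (hcw.isBoundedMeasurable isClosed_closedQuadrant)
      (ContinuousOn.congr (by fun_prop) heqw)
    rwa [cfc_congr heqw, cfc_im_add_I_smul hS.isSelfAdjoint hT.isSelfAdjoint] at h

end Joint

/-! ### The filter equation -/

section Filter

/-- The cutoff to the support of `fu` is redundant: where `fu` vanishes, so does the quotient, with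
`0 / 0 = 0`. -/
theorem filterFunction_eq (fu fw : ℂ → ℝ) (z : ℂ) :
    filterFunction fu fw z = fu z / (fu z + fw z) := by
  by_cases hz : z ∈ tsupport fu
  · exact indicator_of_mem hz _
  · rw [filterFunction, indicator_of_notMem hz, image_eq_zero_of_notMem_tsupport hz, zero_div]

theorem filterFunction_nonneg {fu fw : ℂ → ℝ} (hu : ∀ z, 0 ≤ fu z) (hw : ∀ z, 0 ≤ fw z) (z : ℂ) :
    0 ≤ filterFunction fu fw z := by
  rw [filterFunction_eq]
  exact div_nonneg (hu z) (add_nonneg (hu z) (hw z))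

theorem isBoundedMeasurable_filterFunction {fu fw : ℂ → ℝ} (hu : ∀ z, 0 ≤ fu z)
    (hw : ∀ z, 0 ≤ fw z) (hmu : IsBoundedMeasurable fun z => (fu z : ℂ))
    (hmw : IsBoundedMeasurable fun z => (fw z : ℂ)) :
    IsBoundedMeasurable fun z => (filterFunction fu fw z : ℂ) := by
  refine ⟨?_, 1, fun z => ?_⟩
  · simp only [filterFunction_eq, Complex.ofReal_div, Complex.ofReal_add]
    exact hmu.1.div (hmu.1.add hmw.1)
  · rw [Complex.norm_real, Real.norm_of_nonneg (filterFunction_nonneg hu hw z), filterFunction_eq]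
    exact div_le_one_of_le₀ (le_add_of_nonneg_right (hw z)) (add_nonneg (hu z) (hw z))

variable {H : Type*} [NormedAddCommGroup H] [InnerProductSpace ℂ H] [CompleteSpace H]
  {E : ProjectionValuedMeasure ℂ H} {fu fw : ℂ → ℝ} {S T : H →L[ℂ] H}

theorem filter_residual_ne_zero_iff (hu : ∀ z, 0 ≤ fu z) (hw : ∀ z, 0 ≤ fw z) (g : ℂ → ℂ) (z : ℂ) :
    (fu z : ℂ) - g z * ((fu z : ℂ) + (fw z : ℂ)) ≠ 0 ↔
      fu z + fw z ≠ 0 ∧ g z ≠ (filterFunction fu fw z : ℂ) := by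
  rw [filterFunction_eq]
  by_cases h : fu z + fw z = 0
  · have h1 : fu z = 0 := by linarith [hu z, hw z]
    have h2 : fw z = 0 := by linarith [hu z, hw z]
    simp [h1, h2]
  · have h' : (fu z : ℂ) + (fw z : ℂ) ≠ 0 := by exact_mod_cast h
    simp only [h, not_false_eq_true, true_and, ne_eq, Complex.ofReal_div, Complex.ofReal_add,
      eq_div_iff h', sub_eq_zero, not_iff_not]
    exact eq_comm

/-- An integral `∫ g dΠ` solves the filter equation precisely if the residual
`fu - g (fu + fw)` vanishes almost everywhere. -/
theorem filter_equation_iff (hE : E.HasBorelCalculus) (hu : ∀ z, 0 ≤ fu z) (hw : ∀ z, 0 ≤ fw z)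
    (hS : E.HasIntegral (fun z => (fu z : ℂ)) S) (hT : E.HasIntegral (fun z => (fw z : ℂ)) T)
    {g : ℂ → ℂ} {G : H →L[ℂ] H} (hG : E.HasIntegral g G) :
    S = G * (S + T) ↔
      E.proj {z | fu z + fw z ≠ 0 ∧ g z ≠ (filterFunction fu fw z : ℂ)} = 0 := by
  rw [← sub_eq_zero, hE.eq_zero_iff (hS.sub (hE.mul hG (hS.add hT)))]
  simp only [filter_residual_ne_zero_iff hu hw]

/-- The range of `D⋆` lies in the kernel of the self-adjoint operator `K`, so that `D D⋆ = 0`. -/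
theorem eq_zero_of_mul_eq_zero_of_ker {K D : H →L[ℂ] H} (hK : IsSelfAdjoint K) (h : D * K = 0)
    (hker : ∀ x, K x = 0 → D x = 0) : D = 0 := by
  have h1 : K * star D = 0 := by
    have := congrArg star h
    rwa [star_mul, hK.star_eq, star_zero] at this
  have h2 : D * star D = 0 := by
    ext x
    exact hker _ (DFunLike.congr_fun h1 x)
  exact CStarRing.mul_star_self_eq_zero_iff D |>.1 h2

end Filter

end

theorem theorem5 (d : ℕ) {Ω : Type*} [MeasurableSpace Ω] (P : Measure Ω) [IsProbabilityMeasure P]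
    (u w : TemperedGSP d P) (huw : u.Uncorrelated w)
    {H : Type*} [NormedAddCommGroup H] [InnerProductSpace ℂ H] [CompleteSpace H]
    (J : DistributionInclusion d H) (Ku Kw : H →L[ℂ] H)
    (hu : J.IsCovariance u Ku) (hw : J.IsCovariance w Kw)
    (hKu : Ku.IsPositive) (hKw : Kw.IsPositive) (hcomm : Ku * Kw = Kw * Ku) :
    ∃ (E : ProjectionValuedMeasure ℂ H) (fu fw : ℂ → ℝ),
      E.IsCompactlySupportedIn closedQuadrant ∧
      IsCcOn closedQuadrant fu ∧ IsCcOn closedQuadrant fw ∧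
      (∀ z, 0 ≤ fu z) ∧ (∀ z, 0 ≤ fw z) ∧
      E.HasIntegral (fun z => (fu z : ℂ)) Ku ∧
      E.HasIntegral (fun z => (fw z : ℂ)) Kw ∧
      ∃ F : H →L[ℂ] H,
        E.HasIntegral (fun z => (filterFunction fu fw z : ℂ)) F ∧
        Ku = F * (Ku + Kw) ∧
        F.IsPositive ∧
        -- the bounded Borel functions that solve the equation are those that agree with the
        -- filter function almost everywhere where `fu + fw` does not vanish
        (∀ (g : ℂ → ℂ) (G : H →L[ℂ] H), E.HasIntegral g G →
          (Ku = G * (Ku + Kw) ↔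
            E.proj {z | fu z + fw z ≠ 0 ∧ g z ≠ (filterFunction fu fw z : ℂ)} = 0)) ∧
        -- `F` is the only solution in the bounded functional calculus that vanishes on the kernel
        (∀ x : H, (Ku + Kw) x = 0 → F x = 0) ∧
        (∀ G ∈ E.boundedCalculus, Ku = G * (Ku + Kw) →
          (∀ x : H, (Ku + Kw) x = 0 → G x = 0) → G = F) ∧
        -- `F` is the only solution in the bounded functional calculus if, and only if, the sum of
        -- the covariance operators is injective
        ((∀ G ∈ E.boundedCalculus, Ku = G * (Ku + Kw) → G = F) ↔
          Function.Injective (Ku + Kw)) := by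
  obtain ⟨E, fu, fw, hE, hsupp, hcu, hcw, hu0, hw0, hSu, hSw⟩ :=
    exists_joint_projectionValuedMeasure hKu hKw hcomm
  obtain ⟨F, hF⟩ := hE.exists_integral _ (isBoundedMeasurable_filterFunction hu0 hw0
    hSu.isBoundedMeasurable hSw.isBoundedMeasurable)
  have heq : ∀ (g : ℂ → ℂ) (G : H →L[ℂ] H), E.HasIntegral g G → (Ku = G * (Ku + Kw) ↔
      E.proj {z | fu z + fw z ≠ 0 ∧ g z ≠ (filterFunction fu fw z : ℂ)} = 0) :=
    fun g G hG => filter_equation_iff hE hu0 hw0 hSu hSw hG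
  have hFsol : Ku = F * (Ku + Kw) := by
    rw [heq _ F hF]
    simp [E.proj_empty]
  have hsum := hSu.add hSw
  have hM : MeasurableSet {z | (fu z : ℂ) + (fw z : ℂ) ≠ 0} :=
    ProjectionValuedMeasure.HasBorelCalculus.measurableSet_ne_zero hsum.1
  have hker : ∀ x : H, (Ku + Kw) x = 0 → F x = 0 := by
    intro x hx
    rw [hE.apply_eq_zero_iff hsum, ← E.scalarMeasure_eq_zero_iff x hM] at hx
    rw [hE.apply_eq_zero_iff hF, ← E.scalarMeasure_eq_zero_iff x
      (ProjectionValuedMeasure.HasBorelCalculus.measurableSet_ne_zero hF.1)]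
    -- the filter function vanishes wherever `fu + fw` does
    refine measure_mono_null (fun z hz => ?_) hx
    intro h
    refine hz ?_
    have h' : fu z + fw z = 0 := by exact_mod_cast h
    simp [filterFunction_eq, h']
  have huniq : ∀ G : H →L[ℂ] H, Ku = G * (Ku + Kw) →
      (∀ x : H, (Ku + Kw) x = 0 → G x = 0) → G = F := by
    intro G hG hGker
    refine sub_eq_zero.1 (eq_zero_of_mul_eq_zero_of_ker (K := Ku + Kw)
      (hKu.isSelfAdjoint.add hKw.isSelfAdjoint) ?_ fun x hx => ?_)
    · rw [sub_mul, ← hG, ← hFsol, sub_self]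
    · rw [sub_apply, hGker x hx, hker x hx, sub_zero]
  refine ⟨E, fu, fw, hsupp, hcu, hcw, hu0, hw0, hSu, hSw, F, hF, hFsol,
    hF.isPositive (filterFunction_nonneg hu0 hw0), heq, hker, fun G _ => huniq G, ?_, ?_⟩
  · intro h
    -- `F + Π({fu + fw = 0})` is a solution as well, so that uniqueness makes the projection vanish
    have hind := hF.add (E.hasIntegral_indicator_one hM.compl)
    have h0 : E.proj {z | (fu z : ℂ) + (fw z : ℂ) ≠ 0}ᶜ = 0 := by
      refine add_eq_left.1 (h _ ⟨_, hind⟩ ((heq _ _ hind).2 ?_))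
      convert E.proj_empty
      refine eq_empty_of_forall_notMem fun z hz => hz.2 ?_
      have h' : (fu z : ℂ) + (fw z : ℂ) ≠ 0 := by exact_mod_cast hz.1
      simp [h']
    rw [injective_iff_map_eq_zero]
    intro x hx
    rw [hE.apply_eq_zero_iff hsum, ← E.scalarMeasure_eq_zero_iff x hM] at hx
    have hx' := (E.scalarMeasure_eq_zero_iff x hM.compl).2 (by rw [h0]; rfl)
    have huniv : E.scalarMeasure x univ = 0 := by
      rw [← union_compl_self {z | (fu z : ℂ) + (fw z : ℂ) ≠ 0}]
      exact measure_union_null hx hx'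
    rw [E.scalarMeasure_eq_zero_iff x MeasurableSet.univ, E.proj_univ] at huniv
    exact huniv
  · intro hinj G _ hG
    refine huniq G hG fun x hx => ?_
    rw [hinj (hx.trans (map_zero _).symm), map_zero]
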